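/- Let $n\ge 2$ be even and let $\mathbb{R}^{1,n-1}$ be Minkowski spacetime, i.e. $\mathbb{R}^n$ with coordinates $x^0,\dots,x^{n-1}$ and metric $g=\mathrm{diag}(-1,1,\dots,1)$, time-oriented by $\partial_0$. Let $\gamma^0,\dots,\gamma^{n-1}$ be flat gamma matrices, i.e. complex matrices of size $2^{n/2}$ with $\gamma^\mu\gamma^\nu+\gamma^\nu\gamma^\mu=2g^{\mu\nu}$, $\gamma^0$ anti-Hermitian and $\gamma^a$ Hermitian for $a\ge 1$. Let $\mathcal{H}=L^2(\mathbb{R}^{1,n-1},\mathbb{C}^{2^{n/2}})$, let $D=-i\gamma^\mu\partial_\mu$ be the flat Dirac operator on $\mathcal{H}$ (in the sense of distributions, with domain $\{\phi\in\mathcal{H}: -i\gamma^\mu\partial_\mu\phi\in\mathcal{H}\}$), let $\mathcal{J}=i\gamma^0$ and $\gamma=(-i)^{\frac n2+1}\gamma^0\gamma^1\cdots\gamma^{n-1}$. For $f\in C^\infty(\mathbb{R}^{1,n-1},\mathbb{R})$, write $\mathcal{J}([D,f]+i\gamma)\le 0$ if $\langle\phi,\mathcal{J}([D,f]+i\gamma)\phi\rangle\le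 0$ for all $\phi\in\mathcal{H}$ in the domain of the commutator $[D,f]=Df-fD$, where $f$ acts by pointwise multiplication. Define $$\widetilde d(p,q)=\inf\bigl\{\max\{0,f(q)-f(p)\} : f\in C^\infty(\mathbb{R}^{1,n-1},\mathbb{R}),\ \mathcal{J}([D,f]+i\gamma)\le 0\bigr\}.$$ Let $d(p,q)\in[0,+\infty]$ be the Lorentzian distance: the supremum of the lengths $\int_0^1\sqrt{-g(\dot c(t),\dot c(t))}\,dt$ over all future-directed causal piecewise smooth curves $c$ with $c(0)=p$ and $c(1)=q$, and $0$ if there is no such curve. Then $\widetilde d(p,q)=d(p,q)$ for all $p,q\in\mathbb{R}^{1,n-1}$. Moreover, if $p\prec\!\!\prec q$ (i.e. there is a future-directed timelike piecewise smooth curve from $p$ to $q$), then the infimum is attained by an affine function: there is an affine $f:\mathbb{R}^{1,n-1}\to\mathbb{R}$ with $\mathcal{J}([D,f]+i\gamma)\le 0$ and $\max\{0,f(q)-f(p)\}=d(p,q)$. -/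

import Mathlib

open MeasureTheory Set Filter Topology
open scoped ContDiff ENNReal Matrix ComplexOrder

noncomputable section

namespace MinkowskiTriple

/-! ### Minkowski spacetime and its Lorentzian distance -/

/-- The vector space `ℝ^{1,n-1}`; the coordinate with index `0` is the time coordinate. -/
abbrev Spacetime (n : ℕ) : Type := Fin n → ℝ

variable {n : ℕ}

/-- The diagonal entries `-1, 1, …, 1` of the flat metric in cartesian coordinates. -/
def signature [NeZero n] (μ : Fin n) : ℝ := if μ = 0 then -1 else 1

/-- The Minkowski metric `g(v, w) = -v⁰w⁰ + v¹w¹ + ⋯ + v^{n-1}w^{n-1}`. -/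
def metric [NeZero n] (v w : Spacetime n) : ℝ := ∑ μ, signature μ * v μ * w μ

/-- Future directed causal vectors: non-zero vectors with `g(v, v) ≤ 0` pointing to the future
(a causal vector with positive time component is automatically non-zero). -/
def FutureCausal [NeZero n] (v : Spacetime n) : Prop := metric v v ≤ 0 ∧ 0 < v 0

/-- Future directed timelike vectors. -/
def FutureTimelike [NeZero n] (v : Spacetime n) : Prop := metric v v < 0 ∧ 0 < v 0

/-- `c` restricted to `[0, 1]` is a piecewise smooth curve from `p` to `q` all of whose tangent
vectors (the one-sided ones at the break points included) satisfy `P`. -/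
def IsCurve (P : Spacetime n → Prop) (p q : Spacetime n) (c : ℝ → Spacetime n) : Prop :=
  c 0 = p ∧ c 1 = q ∧ ∃ (k : ℕ) (t : ℕ → ℝ), t 0 = 0 ∧ t k = 1 ∧
    ∀ i < k, t i < t (i + 1) ∧ ContDiffOn ℝ ∞ c (Icc (t i) (t (i + 1))) ∧
      ∀ s ∈ Icc (t i) (t (i + 1)), P (derivWithin c (Icc (t i) (t (i + 1))) s)

/-- The length `∫₀¹ √(-g(ċ, ċ)) dt` of a causal curve
(the velocity is undefined at most at the finitely many break points). -/
def curveLength [NeZero n] (c : ℝ → Spacetime n) : ℝ≥0∞ :=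
  ∫⁻ t in Icc (0 : ℝ) 1, ENNReal.ofReal (Real.sqrt (-metric (deriv c t) (deriv c t)))

/-- The Lorentzian distance: the supremum of the lengths of the future directed causal piecewise
smooth curves from `p` to `q`. It is `0` if there is no such curve. -/
def lorentzDist [NeZero n] (p q : Spacetime n) : ℝ≥0∞ :=
  ⨆ (c : ℝ → Spacetime n) (_ : IsCurve FutureCausal p q c), curveLength c

/-- The chronological relation `p ≪ q`. -/
def Chronological [NeZero n] (p q : Spacetime n) : Prop := ∃ c, IsCurve FutureTimelike p q c

/-! ### Gamma matrices, spinors and the operators of the spectral triple -/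

/-- Complex square matrices of size `2^⌊n/2⌋`. -/
abbrev SpinMatrix (n : ℕ) : Type := Matrix (Fin (2 ^ (n / 2))) (Fin (2 ^ (n / 2))) ℂ

/-- Flat gamma matrices: `γ^μ γ^ν + γ^ν γ^μ = 2 g^{μν}`, with `γ^0` anti-Hermitian and the other
ones Hermitian. -/
structure IsGamma [NeZero n] (γ : Fin n → SpinMatrix n) : Prop where
  clifford : ∀ μ ν, γ μ * γ ν + γ ν * γ μ = if μ = ν then ((2 * signature μ : ℝ) : ℂ) • 1 else 0
  antiHermitian_zero : (γ 0)ᴴ = -γ 0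
  isHermitian : ∀ μ, μ ≠ 0 → (γ μ).IsHermitian

open scoped Kronecker in
/-- Hermitian matrices of size `2^m` representing the Euclidean Clifford relations. -/
theorem exists_euclidean (m : ℕ) : ∃ (ι : Type) (_ : Fintype ι) (_ : DecidableEq ι)
    (e : ℕ → Matrix ι ι ℂ), Fintype.card ι = 2 ^ m ∧ (∀ μ, (e μ)ᴴ = e μ) ∧
      ∀ μ < 2 * m, ∀ ν < 2 * m, e μ * e ν + e ν * e μ = if μ = ν then (2 : ℂ) • 1 else 0 := by
  induction m with
  | zero => exact ⟨Unit, inferInstance, inferInstance, fun _ => 0, by simp, by simp, by simp⟩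
  | succ m ih =>
    obtain ⟨ι, _, _, e, hc, hh, hr⟩ := ih
    let s1 : Matrix (Fin 2) (Fin 2) ℂ := !![0, 1; 1, 0]
    let s2 : Matrix (Fin 2) (Fin 2) ℂ := !![0, -Complex.I; Complex.I, 0]
    let s3 : Matrix (Fin 2) (Fin 2) ℂ := !![1, 0; 0, -1]
    have t1 : s1ᴴ = s1 := by ext i j; fin_cases i <;> fin_cases j <;> simp [s1]
    have t2 : s2ᴴ = s2 := by ext i j; fin_cases i <;> fin_cases j <;> simp [s2]
    have t3 : s3ᴴ = s3 := by ext i j; fin_cases i <;> fin_cases j <;> simp [s3]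
    have q1 : s1 * s1 = 1 := by ext i j; fin_cases i <;> fin_cases j <;> simp [s1]
    have q2 : s2 * s2 = 1 := by ext i j; fin_cases i <;> fin_cases j <;> simp [s2]
    have q3 : s3 * s3 = 1 := by ext i j; fin_cases i <;> fin_cases j <;> simp [s3]
    have a12 : s2 * s1 = -(s1 * s2) := by
      ext i j; fin_cases i <;> fin_cases j <;> simp [s1, s2]
    have a13 : s3 * s1 = -(s1 * s3) := by
      ext i j; fin_cases i <;> fin_cases j <;> simp [s1, s3]
    have a23 : s3 * s2 = -(s2 * s3) := by
      ext i j; fin_cases i <;> fin_cases j <;> simp [s2, s3]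
    have kn : ∀ (A : Matrix ι ι ℂ) (B : Matrix (Fin 2) (Fin 2) ℂ), A ⊗ₖ (-B) = -(A ⊗ₖ B) := by
      intro A B; ext i j; simp [Matrix.kroneckerMap_apply]
    refine ⟨ι × Fin 2, inferInstance, inferInstance, fun μ =>
      if μ < 2 * m then e μ ⊗ₖ s3 else if μ = 2 * m then 1 ⊗ₖ s1 else 1 ⊗ₖ s2,
      by simp [hc, pow_succ], ?_, ?_⟩
    · intro μ
      dsimp only
      split_ifs <;> simp [Matrix.conjTranspose_kronecker, hh, t1, t2, t3]
    · intro μ hμ ν hν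
      have two : ∀ A : Matrix (ι × Fin 2) (ι × Fin 2) ℂ, A + A = (2 : ℂ) • A :=
        fun A => (two_smul ℂ A).symm
      by_cases h1 : μ < 2 * m <;> by_cases h2 : ν < 2 * m
      · simp only [h1, h2, if_true, ← Matrix.mul_kronecker_mul, q3, ← Matrix.add_kronecker,
          hr μ h1 ν h2]
        split_ifs <;> simp [Matrix.smul_kronecker]
      · have hne : μ ≠ ν := by omega
        simp only [h1, h2, hne, if_true, if_false]
        split_ifs <;>
          simp only [← Matrix.mul_kronecker_mul, a13, a23, kn, one_mul, mul_one, neg_add_cancel]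
      · have hne : μ ≠ ν := by omega
        simp only [h1, h2, hne, if_true, if_false]
        split_ifs <;>
          simp only [← Matrix.mul_kronecker_mul, a13, a23, kn, one_mul, mul_one, add_neg_cancel]
      · simp only [h1, h2, if_false]
        by_cases h3 : μ = 2 * m <;> by_cases h4 : ν = 2 * m
        · simp [h3, h4, ← Matrix.mul_kronecker_mul, q1, two]
        · have hne : μ ≠ ν := by omega
          simp only [h3, h4, if_true, if_false, ← Matrix.mul_kronecker_mul, a12, kn, one_mul,
            add_neg_cancel, if_neg (Ne.symm h4)]
        · simp only [h3, h4, if_true, if_false, ← Matrix.mul_kronecker_mul, a12, kn, one_mul,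
            neg_add_cancel]
        · have heq : μ = ν := by omega
          subst heq
          simp [h3, ← Matrix.mul_kronecker_mul, q2, two]

/-- Flat gamma matrices of size `2^⌊n/2⌋` exist in every even dimension. -/
theorem exists_isGamma [NeZero n] (hn : Even n) : ∃ γ : Fin n → SpinMatrix n, IsGamma γ := by
  obtain ⟨ι, _, _, e, hc, hh, hr⟩ := exists_euclidean (n / 2)
  have h2 : 2 * (n / 2) = n := Nat.two_mul_div_two_of_even hn
  rw [h2] at hr
  let E := Matrix.reindexAlgEquiv ℂ ℂ (Fintype.equivFinOfCardEq hc)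
  have hE : ∀ A, (E A)ᴴ = E Aᴴ := fun A => rfl
  let c : Fin n → ℂ := fun μ => if μ = 0 then Complex.I else 1
  refine ⟨fun μ => c μ • E (e μ), ?_, ?_, ?_⟩
  · intro μ ν
    have h : c μ • E (e μ) * c ν • E (e ν) + c ν • E (e ν) * c μ • E (e μ)
        = (c μ * c ν) • E (e μ * e ν + e ν * e μ) := by
      simp only [map_add, map_mul, smul_add, smul_mul_smul_comm, mul_comm (c ν)]
    rw [h, hr μ μ.2 ν ν.2]
    by_cases hμ : μ = ν
    · subst hμ
      by_cases h0 : μ = 0 <;> simp [c, h0, signature]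
    · simp [hμ, Fin.val_inj]
  · simp [c, hE, hh]
  · intro μ hμ
    simp [c, hμ, Matrix.IsHermitian, hE, hh]

/-- The chirality matrix `γ = (-i)^{n/2+1} γ^0 ⋯ γ^{n-1}`. -/
def chirality (γ : Fin n → SpinMatrix n) : SpinMatrix n :=
  (-Complex.I) ^ (n / 2 + 1) • (List.ofFn γ).prod

/-- The fibre `ℂ^{2^⌊n/2⌋}` of the spinor bundle. -/
abbrev Spinor (n : ℕ) : Type := EuclideanSpace ℂ (Fin (2 ^ (n / 2)))

/-- The Hilbert space of square integrable spinor fields. -/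
abbrev SpinorL2 (n : ℕ) : Type := Lp (Spinor n) 2 (volume : Measure (Spacetime n))

/-- A constant matrix as an operator on spinors. -/
abbrev spinAct (A : SpinMatrix n) : Spinor n →L[ℂ] Spinor n := Matrix.toEuclideanCLM (𝕜 := ℂ) A

/-- A constant matrix as a bounded operator on the Hilbert space. -/
def constOp (A : SpinMatrix n) : SpinorL2 n →L[ℂ] SpinorL2 n :=
  (spinAct A).compLpL 2 volume

/-- The fundamental symmetry `𝒥 = iγ⁰`. -/
def fundSymm [NeZero n] (γ : Fin n → SpinMatrix n) : SpinorL2 n →L[ℂ] SpinorL2 n :=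
  constOp (Complex.I • γ 0)

/-- The `μ`-th partial derivative of a real function. -/
def partialDeriv (μ : Fin n) (f : Spacetime n → ℝ) (x : Spacetime n) : ℝ :=
  fderiv ℝ f x (Pi.single μ 1)

/-- `ψ = -iγ^μ ∂_μ φ` in the sense of distributions: for every test function `η`,
`∫ η ψ = i ∑_μ γ^μ ∫ (∂_μ η) φ`. -/
def IsWeakDirac (γ : Fin n → SpinMatrix n) (φ ψ : SpinorL2 n) : Prop :=
  ∀ η : Spacetime n → ℝ, ContDiff ℝ ∞ η → HasCompactSupport η →
    ∫ x, η x • ψ x = Complex.I • ∑ μ, spinAct (γ μ) (∫ x, partialDeriv μ η x • φ x)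

theorem integrable_test_smul {η : Spacetime n → ℝ} (hη : Continuous η) (hc : HasCompactSupport η)
    (φ : SpinorL2 n) : Integrable (fun x => η x • φ x) :=
  ((Lp.memLp φ).locallyIntegrable (by norm_num)).integrable_smul_left_of_hasCompactSupport hη hc

theorem continuous_partialDeriv {η : Spacetime n → ℝ} (hη : ContDiff ℝ ∞ η) (μ : Fin n) :
    Continuous (partialDeriv μ η) :=
  (hη.continuous_fderiv (by simp)).clm_apply continuous_const

theorem hasCompactSupport_partialDeriv {η : Spacetime n → ℝ} (hc : HasCompactSupport η)
    (μ : Fin n) : HasCompactSupport (partialDeriv μ η) :=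
  hc.fderiv_apply (𝕜 := ℝ) (Pi.single μ 1)

theorem integral_test_add {η : Spacetime n → ℝ} (hη : Continuous η) (hc : HasCompactSupport η)
    (φ ψ : SpinorL2 n) :
    ∫ x, η x • (φ + ψ : SpinorL2 n) x = (∫ x, η x • φ x) + ∫ x, η x • ψ x := by
  rw [← integral_add (integrable_test_smul hη hc φ) (integrable_test_smul hη hc ψ)]
  refine integral_congr_ae ?_
  filter_upwards [Lp.coeFn_add φ ψ] with x hx
  rw [hx, Pi.add_apply, smul_add]

theorem integral_test_smul (η : Spacetime n → ℝ) (a : ℂ) (φ : SpinorL2 n) :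
    ∫ x, η x • (a • φ : SpinorL2 n) x = a • ∫ x, η x • φ x := by
  rw [← integral_smul]
  refine integral_congr_ae ?_
  filter_upwards [Lp.coeFn_smul a φ] with x hx
  rw [hx, Pi.smul_apply, smul_comm]

theorem integral_test_zero (η : Spacetime n → ℝ) :
    ∫ x, η x • (0 : SpinorL2 n) x = 0 := by
  have h := integral_test_smul η 0 (0 : SpinorL2 n)
  rwa [zero_smul, zero_smul] at h

/-- The graph of the flat Dirac operator on its maximal domain. -/
def diracGraph (γ : Fin n → SpinMatrix n) : Submodule ℂ (SpinorL2 n × SpinorL2 n) where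
  carrier := {z | IsWeakDirac γ z.1 z.2}
  zero_mem' := by
    intro η _ _
    simp only [Prod.fst_zero, Prod.snd_zero, integral_test_zero, map_zero, Finset.sum_const_zero,
      smul_zero]
  add_mem' := by
    intro y z hy hz η hη hc
    have h := fun μ => integral_test_add (continuous_partialDeriv hη μ)
      (hasCompactSupport_partialDeriv hc μ) y.1 z.1
    simp only [Prod.fst_add, Prod.snd_add, integral_test_add hη.continuous hc, h, map_add,
      Finset.sum_add_distrib, smul_add, hy η hη hc, hz η hη hc]
  smul_mem' := by
    intro a z hz η hη hc
    simp only [Prod.smul_fst, Prod.smul_snd, integral_test_smul, map_smul, ← Finset.smul_sum,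
      hz η hη hc, smul_comm a Complex.I]

/-- The flat Dirac operator `D = -iγ^μ ∂_μ`, an unbounded operator whose domain consists of the
`φ ∈ L²` for which the distribution `-iγ^μ ∂_μ φ` lies in `L²`. -/
def dirac (γ : Fin n → SpinMatrix n) : SpinorL2 n →ₗ.[ℂ] SpinorL2 n :=
  (diracGraph γ).toLinearPMap

/-- The weak definition determines `Dφ`, so `diracGraph` is the graph of `dirac`. -/
theorem dirac_graph (γ : Fin n → SpinMatrix n) : (dirac γ).graph = diracGraph γ := by
  refine Submodule.toLinearPMap_graph_eq _ ?_
  rintro ⟨φ, ψ⟩ h (rfl : φ = 0)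
  have h' : ∀ᵐ x, ψ x = 0 := by
    refine ae_eq_zero_of_integral_contDiff_smul_eq_zero
      ((Lp.memLp ψ).locallyIntegrable (by norm_num)) fun η hη hc => ?_
    have := h η hη hc
    simpa only [integral_test_zero, map_zero, Finset.sum_const_zero, smul_zero] using this
  exact (Lp.eq_zero_iff_ae_eq_zero).2 h'

/-- The functions `φ ∈ L²` with `fφ ∈ L²`. -/
def mulDomain (f : Spacetime n → ℝ) : Submodule ℂ (SpinorL2 n) where
  carrier := {φ | MemLp (fun x => (f x : ℂ) • φ x) 2 volume}
  zero_mem' := by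
    refine (memLp_congr_ae ?_).2 (MemLp.zero (ε := Spinor n))
    filter_upwards [Lp.coeFn_zero (Spinor n) 2 (volume : Measure (Spacetime n))] with x hx
    rw [hx]; simp
  add_mem' := by
    intro φ ψ hφ hψ
    refine (memLp_congr_ae ?_).2 (MemLp.add hφ hψ)
    filter_upwards [Lp.coeFn_add φ ψ] with x hx
    simp only [hx, Pi.add_apply, smul_add]
  smul_mem' := by
    intro a φ hφ
    refine (memLp_congr_ae ?_).2 (MemLp.const_smul hφ a)
    filter_upwards [Lp.coeFn_smul a φ] with x hx
    simp only [hx, Pi.smul_apply, smul_comm a]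

/-- Pointwise multiplication by a real function `f`, as an unbounded operator with domain
`{φ ∈ L² | fφ ∈ L²}`. -/
def mulOp (f : Spacetime n → ℝ) : SpinorL2 n →ₗ.[ℂ] SpinorL2 n where
  domain := mulDomain f
  toFun :=
    { toFun := fun φ => MemLp.toLp (fun x => (f x : ℂ) • (φ : SpinorL2 n) x) φ.2
      map_add' := by
        intro φ ψ
        apply Lp.ext
        filter_upwards [MemLp.coeFn_toLp (φ + ψ).2, MemLp.coeFn_toLp φ.2, MemLp.coeFn_toLp ψ.2,
          Lp.coeFn_add (φ : SpinorL2 n) (ψ : SpinorL2 n),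
          Lp.coeFn_add (MemLp.toLp _ φ.2) (MemLp.toLp _ ψ.2)] with x h1 h2 h3 h4 h5
        rw [h1, h5, Pi.add_apply, h2, h3, Submodule.coe_add, h4, Pi.add_apply, smul_add]
      map_smul' := by
        intro a φ
        apply Lp.ext
        filter_upwards [MemLp.coeFn_toLp (a • φ).2, MemLp.coeFn_toLp φ.2,
          Lp.coeFn_smul a (φ : SpinorL2 n),
          Lp.coeFn_smul a (MemLp.toLp _ φ.2)] with x h1 h2 h3 h4
        rw [RingHom.id_apply, h1, h4, Pi.smul_apply, h2, Submodule.coe_smul, h3, Pi.smul_apply,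
          smul_comm] }

/-- The product `ST` of unbounded operators on its natural domain
`{φ ∈ dom T | Tφ ∈ dom S}`. -/
def opProd {H : Type*} [AddCommGroup H] [Module ℂ H] (S T : H →ₗ.[ℂ] H) : H →ₗ.[ℂ] H where
  domain := (S.domain.comap T.toFun).map T.domain.subtype
  toFun :=
    { toFun := fun φ => S ⟨T ⟨φ, by obtain ⟨_, y, _, rfl⟩ := φ; exact y.2⟩, by
        obtain ⟨_, y, hy, rfl⟩ := φ; exact hy⟩
      map_add' := by
        intro φ ψ
        rw [← S.map_add]
        congr 1
        ext
        exact T.map_add ⟨φ, _⟩ ⟨ψ, _⟩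
      map_smul' := by
        intro a φ
        rw [RingHom.id_apply, ← S.map_smul]
        congr 1
        ext
        exact T.map_smul a ⟨φ, _⟩ }

/-- The commutator `[D, f]`, defined on `dom (Df) ∩ dom (fD)`. -/
def diracComm (γ : Fin n → SpinMatrix n) (f : Spacetime n → ℝ) : SpinorL2 n →ₗ.[ℂ] SpinorL2 n :=
  opProd (dirac γ) (mulOp f) - opProd (mulOp f) (dirac γ)

/-- The algebraic constraint: `⟨φ, 𝒥([D, f] + iγ)φ⟩ ≤ 0` for all `φ` on which `[D, f]` is defined
(the inequality in `ℂ` says that the left side is real and non-positive). -/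
def Constraint [NeZero n] (γ : Fin n → SpinMatrix n) (f : Spacetime n → ℝ) : Prop :=
  ∀ φ : (diracComm γ f).domain,
    inner ℂ (φ : SpinorL2 n)
      (fundSymm γ (diracComm γ f φ + Complex.I • constOp (chirality γ) φ)) ≤ 0

/-- The function `d̃(p, q)`: the infimum of `max (0, f(q) - f(p))` over all smooth real functions
satisfying the constraint. -/
def algDist [NeZero n] (γ : Fin n → SpinMatrix n) (p q : Spacetime n) : ℝ≥0∞ :=
  ⨅ (f : Spacetime n → ℝ) (_ : ContDiff ℝ ∞ f ∧ Constraint γ f),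
    ENNReal.ofReal (max 0 (f q - f p))

end MinkowskiTriple

end

noncomputable section

namespace MinkowskiTriple

variable {n : ℕ}

/-! ### Products of anticommuting elements and the chirality matrix -/

/-! The operator `𝒥([D, f] + iγ)` has no derivatives left in it: it multiplies by the matrix `A -
∂_0 f`, where `A = γ^0 (∑_a ∂_a f γ^a - γ)` is Hermitian. By the Clifford relations `A² = 1 +
|∇f|²`, and `A` anticommutes with the invertible `γ^0`, so `√(1 + |∇f|²)` really is its largest
eigenvalue. Testing with spinor fields concentrated near a point turns the operator inequality into
the pointwise one `∂_0 f ≥ √(1 + |∇f|²)` (`IsGamma.constraint_iff`).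

For such `f` the reverse Cauchy-Schwarz inequality bounds the derivative of `f` along a causal curve
below by the length density. Integration gives length `≤ f(q) - f(p)`, hence `d ≤ d̃`
(`lorentzDist_le_algDist`).

For `d̃ ≤ d` linear functions suffice. If `q - p` is future timelike, the normalised covector dual
to it gives equality in reverse Cauchy-Schwarz, and the straight segment has that length. Otherwise
nearly null covectors make `f(q) - f(p)` at most any given `ε > 0`, so `d̃ = 0`. The timelike
covector is also the affine minimiser. -/

theorem mul_list_prod_of_anticomm {R : Type*} [Ring R] {x : R} {L : List R}
    (h : ∀ y ∈ L, x * y = -(y * x)) : x * L.prod = (-1) ^ L.length * (L.prod * x) := by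
  induction L with
  | nil => simp
  | cons y L ih =>
    rw [List.prod_cons, ← mul_assoc, h y List.mem_cons_self, neg_mul, mul_assoc,
      ih fun z hz => h z (List.mem_cons_of_mem _ hz), List.length_cons, pow_succ]
    rcases neg_one_pow_eq_or R L.length with e | e <;> simp [e, mul_assoc]

/-- Passing an occurrence of `x` itself costs no sign, so there is one sign fewer than the length of
the list. -/
theorem mem_mul_list_prod_of_anticomm {R : Type*} [Ring R] {x : R} {L : List R}
    (hL : L.Pairwise fun y z => y * z = -(z * y)) (hx : x ∈ L) :
    x * L.prod = -((-1) ^ L.length * (L.prod * x)) := by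
  induction L with
  | nil => simp at hx
  | cons y L ih =>
    rw [List.pairwise_cons] at hL
    rw [List.prod_cons, List.length_cons, pow_succ]
    rcases List.mem_cons.1 hx with rfl | hx
    · have h1 := mul_list_prod_of_anticomm hL.1
      rw [mul_assoc x, h1]
      rcases neg_one_pow_eq_or R L.length with e | e <;> simp [e]
    · have h1 : x * y = -(y * x) := by rw [hL.1 x hx, neg_neg]
      rw [← mul_assoc, h1, neg_mul, mul_assoc, ih hL.2 hx]
      rcases neg_one_pow_eq_or R L.length with e | e <;> simp [e, mul_assoc]

/-- The adjoint reverses the order of the factors; undoing the reversal takes one swap for each pair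
of factors. -/
theorem conjTranspose_list_prod_of_anticomm {m : Type*} [Fintype m] [DecidableEq m]
    {L : List (Matrix m m ℂ)} (hL : L.Pairwise fun y z => y * z = -(z * y))
    (hh : ∀ y ∈ L, yᴴ = y) : L.prodᴴ = (-1) ^ L.length.choose 2 * L.prod := by
  induction L with
  | nil => simp
  | cons y L ih =>
    rw [List.pairwise_cons] at hL
    rw [List.prod_cons, Matrix.conjTranspose_mul,
      ih hL.2 fun z hz => hh z (List.mem_cons_of_mem _ hz),
      hh y List.mem_cons_self, mul_list_prod_of_anticomm hL.1, List.length_cons,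
      Nat.choose_succ_succ, Nat.choose_one_right, pow_add]
    rcases neg_one_pow_eq_or (Matrix m m ℂ) L.length with e | e <;>
      rcases neg_one_pow_eq_or (Matrix m m ℂ) (L.length.choose 2) with e' | e' <;> simp [e, e']

theorem conjTranspose_list_prod_mul_self {m : Type*} [Fintype m] [DecidableEq m]
    {L : List (Matrix m m ℂ)} (h : ∀ y ∈ L, yᴴ * y = 1) : L.prodᴴ * L.prod = 1 := by
  induction L with
  | nil => simp
  | cons y L ih =>
    rw [List.prod_cons, Matrix.conjTranspose_mul, mul_assoc, ← mul_assoc yᴴ,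
      h y List.mem_cons_self, one_mul, ih fun z hz => h z (List.mem_cons_of_mem _ hz)]

namespace IsGamma

variable [NeZero n] {γ : Fin n → SpinMatrix n}

theorem anticomm (hγ : IsGamma γ) {μ ν : Fin n} (h : μ ≠ ν) : γ μ * γ ν = -(γ ν * γ μ) := by
  have := hγ.clifford μ ν
  rw [if_neg h] at this
  exact eq_neg_of_add_eq_zero_left this

theorem mul_self (hγ : IsGamma γ) (μ : Fin n) : γ μ * γ μ = (signature μ : ℂ) • 1 := by
  have := hγ.clifford μ μ
  rw [if_pos rfl, ← two_smul ℂ, Complex.ofReal_mul, mul_smul] at this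
  exact smul_right_injective _ (two_ne_zero (α := ℂ)) (by simpa using this)

theorem zero_mul_zero (hγ : IsGamma γ) : γ 0 * γ 0 = -1 := by
  simp [hγ.mul_self 0, signature]

theorem conjTranspose_mul_self (hγ : IsGamma γ) (μ : Fin n) : (γ μ)ᴴ * γ μ = 1 := by
  by_cases h : μ = 0
  · rw [h, hγ.antiHermitian_zero, neg_mul, hγ.zero_mul_zero, neg_neg]
  · rw [(hγ.isHermitian μ h).eq, hγ.mul_self, signature, if_neg h]; simp

theorem pairwise_ofFn (hγ : IsGamma γ) :
    (List.ofFn γ).Pairwise fun y z => y * z = -(z * y) := by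
  rw [List.pairwise_ofFn]
  exact fun i j h => hγ.anticomm h.ne

theorem mul_chirality (hγ : IsGamma γ) (hn : Even n) (μ : Fin n) :
    γ μ * chirality γ = -(chirality γ * γ μ) := by
  have h := mem_mul_list_prod_of_anticomm hγ.pairwise_ofFn (List.mem_ofFn.2 ⟨μ, rfl⟩)
  rw [List.length_ofFn, hn.neg_one_pow, one_mul] at h
  rw [chirality, mul_smul_comm, h, smul_mul_assoc, smul_neg]

/-- The anti-Hermitian factor `γ^0` is split off. Moving it past the odd number `n - 1` of spatial
factors gives a sign that cancels the one from its adjoint. What remains is the reversal sign of the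
spatial factors, with exponent `(n - 1)(n/2 - 1)`, of the parity of `n/2 + 1`. -/
theorem conjTranspose_prod (hγ : IsGamma γ) (hn : Even n) :
    (List.ofFn γ).prodᴴ = (-1) ^ (n / 2 + 1) * (List.ofFn γ).prod := by
  obtain ⟨k, rfl⟩ : ∃ k, n = k + 1 := Nat.exists_eq_succ_of_ne_zero (NeZero.ne n)
  obtain ⟨m, hm⟩ := hn
  have hp := hγ.pairwise_ofFn
  rw [List.ofFn_succ, List.pairwise_cons] at hp
  have h1 : (List.ofFn fun i => γ (Fin.succ i)).prodᴴ = _ :=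
    conjTranspose_list_prod_of_anticomm hp.2 (by
      intro y hy
      obtain ⟨i, rfl⟩ := List.mem_ofFn.1 hy
      exact (hγ.isHermitian _ (Fin.succ_ne_zero i)).eq)
  have h2 := mul_list_prod_of_anticomm hp.1
  have h0 := hγ.antiHermitian_zero
  rw [List.length_ofFn] at h1 h2
  have hk : Odd k := ⟨m - 1, by omega⟩
  rw [hk.neg_one_pow, neg_one_mul] at h2
  have hc : k.choose 2 = (2 * m - 1) * (m - 1) := by
    rw [Nat.choose_two_right]
    have : k = 2 * m - 1 := by omega
    rw [this, show 2 * m - 1 - 1 = (m - 1) * 2 by omega, ← mul_assoc, Nat.mul_div_cancel _ two_pos]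
  have hs : (-1 : SpinMatrix (k + 1)) ^ k.choose 2 = (-1) ^ ((k + 1) / 2 + 1) := by
    have ho : Odd (2 * m - 1) := ⟨m - 1, by omega⟩
    rw [hc, pow_mul, ho.neg_one_pow, show (k + 1) / 2 + 1 = (m - 1) + 2 by omega, pow_add]
    simp
  rw [List.ofFn_succ, List.prod_cons, Matrix.conjTranspose_mul, h1, hs]
  change _ * (γ 0)ᴴ = _
  rw [h0, h2, mul_neg, mul_neg, mul_assoc]

/-- Conjugating the prefactor `(-i)^{n/2+1}` produces exactly the sign by which the product of the
gamma matrices fails to be Hermitian. -/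
theorem conjTranspose_chirality (hγ : IsGamma γ) (hn : Even n) :
    (chirality γ)ᴴ = chirality γ := by
  rw [chirality, Matrix.conjTranspose_smul, hγ.conjTranspose_prod hn]
  have h : ((-1 : SpinMatrix n)) ^ (n / 2 + 1) = ((-1 : ℂ) ^ (n / 2 + 1)) • 1 := by
    rw [← Algebra.algebraMap_eq_smul_one, map_pow]; simp
  rw [h, smul_mul_assoc, one_mul, smul_smul]
  congr 1
  simp [← mul_pow]

theorem chirality_mul_self (hγ : IsGamma γ) (hn : Even n) :
    chirality γ * chirality γ = 1 := by
  have h : (List.ofFn γ).prodᴴ * (List.ofFn γ).prod = 1 := conjTranspose_list_prod_mul_self (by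
    intro y hy
    obtain ⟨i, rfl⟩ := List.mem_ofFn.1 hy
    exact hγ.conjTranspose_mul_self i)
  nth_rw 1 [← hγ.conjTranspose_chirality hn]
  rw [chirality, Matrix.conjTranspose_smul, smul_mul_smul_comm, h]
  simp [← mul_pow]

end IsGamma

/-! ### The symbol of `𝒥([D, f] + iγ)` -/

/-- The matrix `∑_a v_a γ^0 γ^a - γ^0 γ`, the sum running over the spatial indices. -/
def spatialSymbol [NeZero n] (γ : Fin n → SpinMatrix n) (v : Spacetime n) : SpinMatrix n :=
  γ 0 * ((∑ a with a ≠ 0, (v a : ℂ) • γ a) - chirality γ)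

/-- The value of `𝒥([D, f] + iγ)` at a point where `f` has the partial derivatives `v`. -/
def symbol [NeZero n] (γ : Fin n → SpinMatrix n) (v : Spacetime n) : SpinMatrix n :=
  (Complex.I • γ 0) * (-Complex.I • ∑ μ, (v μ : ℂ) • γ μ + Complex.I • chirality γ)

/-- The squared euclidean norm of the spatial part of a vector. -/
def spatialSq [NeZero n] (v : Spacetime n) : ℝ := ∑ a with a ≠ 0, v a ^ 2

namespace IsGamma

variable [NeZero n] {γ : Fin n → SpinMatrix n}

/-- Since `γ^0 γ^0 = -1`, the time derivative enters only as a scalar, and negativity of the symbol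
becomes a bound on the spectrum of the spatial part. -/
theorem symbol_eq (hγ : IsGamma γ) (v : Spacetime n) :
    symbol γ v = spatialSymbol γ v - (v 0 : ℂ) • 1 := by
  have h : ∑ μ, (v μ : ℂ) • γ μ = (v 0 : ℂ) • γ 0 + ∑ a with a ≠ 0, (v a : ℂ) • γ a := by
    rw [Finset.filter_ne', Finset.add_sum_erase _ (fun μ => (v μ : ℂ) • γ μ) (Finset.mem_univ 0)]
  rw [symbol, spatialSymbol, h, smul_mul_assoc, mul_add, smul_add, mul_smul_comm, mul_smul_comm,
    smul_smul, smul_smul, mul_neg, Complex.I_mul_I, mul_add, mul_smul_comm, hγ.zero_mul_zero]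
  simp only [mul_sub, smul_neg, neg_smul, one_smul, neg_neg]
  abel

theorem zero_mul_spatial (hγ : IsGamma γ) (hn : Even n) (v : Spacetime n) :
    γ 0 * ((∑ a with a ≠ 0, (v a : ℂ) • γ a) - chirality γ)
      = -(((∑ a with a ≠ 0, (v a : ℂ) • γ a) - chirality γ) * γ 0) := by
  rw [mul_sub, sub_mul, hγ.mul_chirality hn, neg_sub, Finset.mul_sum, Finset.sum_mul,
    sub_neg_eq_add, add_comm, sub_eq_add_neg, ← Finset.sum_neg_distrib]
  congr 1
  refine Finset.sum_congr rfl fun a ha => ?_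
  rw [mul_smul_comm, smul_mul_assoc, hγ.anticomm (Finset.mem_filter.1 ha).2.symm, smul_neg]

theorem isHermitian_spatialSymbol (hγ : IsGamma γ) (hn : Even n) (v : Spacetime n) :
    (spatialSymbol γ v).IsHermitian := by
  have h : ((∑ a with a ≠ 0, (v a : ℂ) • γ a) - chirality γ)ᴴ
      = (∑ a with a ≠ 0, (v a : ℂ) • γ a) - chirality γ := by
    rw [Matrix.conjTranspose_sub, hγ.conjTranspose_chirality hn, Matrix.conjTranspose_sum]
    congr 1
    refine Finset.sum_congr rfl fun a ha => ?_
    rw [Matrix.conjTranspose_smul, (hγ.isHermitian a (Finset.mem_filter.1 ha).2).eq]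
    simp
  rw [Matrix.IsHermitian, spatialSymbol, Matrix.conjTranspose_mul, h, hγ.antiHermitian_zero,
    hγ.zero_mul_spatial hn, mul_neg]

theorem sum_smul_mul_self (hγ : IsGamma γ) (v : Spacetime n) :
    (∑ a with a ≠ 0, (v a : ℂ) • γ a) * (∑ a with a ≠ 0, (v a : ℂ) • γ a)
      = (spatialSq v : ℂ) • 1 := by
  set X := (∑ a with a ≠ 0, (v a : ℂ) • γ a) * (∑ a with a ≠ 0, (v a : ℂ) • γ a) with hX
  have h1 : X = ∑ a with a ≠ (0 : Fin n), ∑ b with b ≠ (0 : Fin n),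
      ((v a : ℂ) * v b) • (γ a * γ b) := by
    simp only [hX, Finset.sum_mul_sum, smul_mul_smul_comm]
  have h2 : X = ∑ a with a ≠ (0 : Fin n), ∑ b with b ≠ (0 : Fin n),
      ((v a : ℂ) * v b) • (γ b * γ a) := by
    rw [h1, Finset.sum_comm]
    simp only [mul_comm]
  -- Adding the two expansions, with the factors in opposite orders, produces anticommutators.
  have h3 : X + X = (2 : ℂ) • (spatialSq v : ℂ) • 1 := by
    nth_rw 1 [h1]
    rw [h2, ← Finset.sum_add_distrib, spatialSq, Complex.ofReal_sum, Finset.sum_smul,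
      Finset.smul_sum]
    refine Finset.sum_congr rfl fun a ha => ?_
    rw [← Finset.sum_add_distrib]
    simp only [← smul_add, hγ.clifford]
    rw [Finset.sum_eq_single_of_mem a ha fun b _ hb => by rw [if_neg hb.symm, smul_zero]]
    rw [if_pos rfl, signature, if_neg (Finset.mem_filter.1 ha).2, smul_smul, smul_smul]
    congr 1
    push_cast
    ring
  rw [← two_smul ℂ] at h3
  exact smul_right_injective _ (two_ne_zero (α := ℂ)) h3

/-- The chirality matrix acts as one more Clifford direction, orthogonal to the spatial ones and of
unit length; it supplies the `1` in `1 + |v|²`. -/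
theorem spatialSymbol_mul_self (hγ : IsGamma γ) (hn : Even n) (v : Spacetime n) :
    spatialSymbol γ v * spatialSymbol γ v = ((1 + spatialSq v : ℝ) : ℂ) • 1 := by
  have hx : (∑ a with a ≠ 0, (v a : ℂ) • γ a) * chirality γ
      = -(chirality γ * ∑ a with a ≠ 0, (v a : ℂ) • γ a) := by
    rw [Finset.sum_mul, Finset.mul_sum, ← Finset.sum_neg_distrib]
    refine Finset.sum_congr rfl fun a _ => ?_
    rw [smul_mul_assoc, mul_smul_comm, hγ.mul_chirality hn, smul_neg]
  have h0 := hγ.zero_mul_spatial hn v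
  have h1 := hγ.sum_smul_mul_self v
  rw [spatialSymbol]
  set X := ∑ a with a ≠ 0, (v a : ℂ) • γ a
  calc γ 0 * (X - chirality γ) * (γ 0 * (X - chirality γ))
      = (γ 0 * (X - chirality γ)) * γ 0 * (X - chirality γ) := by
        rw [mul_assoc, mul_assoc, mul_assoc]
    _ = -((X - chirality γ) * (γ 0 * γ 0) * (X - chirality γ)) := by
      rw [h0, neg_mul, neg_mul, mul_assoc (X - chirality γ)]
    _ = X * X - (X * chirality γ + chirality γ * X) + chirality γ * chirality γ := by
      rw [hγ.zero_mul_zero]; noncomm_ring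
    _ = _ := by
      rw [hx, h1, hγ.chirality_mul_self hn, neg_add_cancel, sub_zero, Complex.ofReal_add,
        add_smul, Complex.ofReal_one, one_smul, add_comm]

theorem zero_mul_spatialSymbol (hγ : IsGamma γ) (hn : Even n) (v : Spacetime n) :
    γ 0 * spatialSymbol γ v = -(spatialSymbol γ v * γ 0) := by
  rw [spatialSymbol, mul_assoc, ← mul_neg, ← hγ.zero_mul_spatial hn]

theorem spinAct_symbol (hγ : IsGamma γ) (v : Spacetime n) (ψ : Spinor n) :
    spinAct (symbol γ v) ψ = spinAct (spatialSymbol γ v) ψ - (v 0 : ℂ) • ψ := by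
  rw [hγ.symbol_eq, spinAct, map_sub, map_smul, map_one]; rfl

theorem spinAct_spatialSymbol_twice (hγ : IsGamma γ) (hn : Even n) (v : Spacetime n)
    (ψ : Spinor n) : spinAct (spatialSymbol γ v) (spinAct (spatialSymbol γ v) ψ)
      = ((1 + spatialSq v : ℝ) : ℂ) • ψ := by
  have := congrArg (fun B => spinAct B ψ) (hγ.spatialSymbol_mul_self hn v)
  simp only [spinAct, map_mul, map_smul, map_one] at this
  exact this

theorem inner_spatialSymbol_left (hγ : IsGamma γ) (hn : Even n) (v : Spacetime n)
    (φ ψ : Spinor n) : inner ℂ (spinAct (spatialSymbol γ v) φ) ψ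
      = inner ℂ φ (spinAct (spatialSymbol γ v) ψ) := by
  have h : star (spinAct (spatialSymbol γ v)) = spinAct (spatialSymbol γ v) := by
    rw [← map_star, Matrix.star_eq_conjTranspose, (hγ.isHermitian_spatialSymbol hn v).eq]
  rw [ContinuousLinearMap.star_eq_adjoint] at h
  nth_rw 1 [← h]
  exact ContinuousLinearMap.adjoint_inner_left _ _ _

end IsGamma

/-! ### Eigenvalues and sign of the symbol -/

theorem inner_self_eq_ofReal (ψ : Spinor n) : inner ℂ ψ ψ = ((‖ψ‖ ^ 2 : ℝ) : ℂ) := by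
  rw [inner_self_eq_norm_sq_to_K]; simp

theorem spatialSq_nonneg [NeZero n] (v : Spacetime n) : 0 ≤ spatialSq v :=
  Finset.sum_nonneg fun a _ => sq_nonneg (v a)

namespace IsGamma

variable [NeZero n] {γ : Fin n → SpinMatrix n}

/-- `√(1 + |v|²)` is an eigenvalue of the spatial part of the symbol. -/
theorem exists_eigenvector (hγ : IsGamma γ) (hn : Even n) (v : Spacetime n) :
    ∃ ψ : Spinor n, ψ ≠ 0 ∧
      spinAct (spatialSymbol γ v) ψ = (Real.sqrt (1 + spatialSq v) : ℂ) • ψ := by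
  have hs := spatialSq_nonneg v
  set s := Real.sqrt (1 + spatialSq v)
  have hs2 : s * s = 1 + spatialSq v := Real.mul_self_sqrt (by positivity)
  have hAA := hγ.spinAct_spatialSymbol_twice hn v
  rw [← hs2] at hAA
  set A := spinAct (spatialSymbol γ v)
  by_contra! hne
  -- From `(A - s)(A + s) = 0`, any nonzero value of `A + s` would be an eigenvector for `s`; so `A
  -- = -s` on all spinors.
  have key (χ : Spinor n) : A χ = -((s : ℂ) • χ) := by
    by_contra hχ
    refine hne (A χ + (s : ℂ) • χ) (fun h0 => hχ (eq_neg_of_add_eq_zero_left h0)) ?_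
    rw [map_add, hAA, map_smul, smul_add, smul_smul, Complex.ofReal_mul, add_comm]
  obtain ⟨χ, hχ⟩ : ∃ χ : Spinor n, χ ≠ 0 := exists_ne 0
  have hc : spinAct (γ 0) (A χ) = -A (spinAct (γ 0) χ) := by
    have := congrArg (fun B => spinAct B χ) (hγ.zero_mul_spatialSymbol hn v)
    simp only [spinAct, map_mul, map_neg] at this
    exact this
  -- A scalar `A` commutes with `γ^0` and yet anticommutes with it, so `2s γ^0 χ = 0`; this
  -- contradicts `γ^0 γ^0 = -1`.
  have hg : spinAct (γ 0) χ = 0 := by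
    rw [key, key, map_neg, map_smul, neg_neg, neg_eq_iff_add_eq_zero, ← two_smul ℂ,
      smul_smul] at hc
    have hs0 : (s : ℂ) ≠ 0 := by
      rw [Complex.ofReal_ne_zero]
      intro h0; rw [h0] at hs2; linarith
    exact (smul_eq_zero.1 hc).resolve_left (mul_ne_zero two_ne_zero hs0)
  have := congrArg (fun B => spinAct B χ) hγ.zero_mul_zero
  simp only [spinAct, map_mul, map_neg, map_one] at this
  change spinAct (γ 0) (spinAct (γ 0) χ) = -χ at this
  rw [hg, map_zero, eq_comm, neg_eq_zero] at this
  exact hχ this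

theorem sqrt_le_of_re_inner_symbol_nonpos (hγ : IsGamma γ) (hn : Even n) {v : Spacetime n}
    (h : ∀ ψ : Spinor n, (inner ℂ ψ (spinAct (symbol γ v) ψ)).re ≤ 0) :
    Real.sqrt (1 + spatialSq v) ≤ v 0 := by
  obtain ⟨ψ, h0, hψ⟩ := hγ.exists_eigenvector hn v
  have h1 := h ψ
  rw [hγ.spinAct_symbol, hψ, ← sub_smul, inner_smul_right, inner_self_eq_ofReal,
    ← Complex.ofReal_sub, ← Complex.ofReal_mul, Complex.ofReal_re] at h1
  have h3 : 0 < ‖ψ‖ ^ 2 := by positivity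
  exact sub_nonpos.1 (nonpos_of_mul_nonpos_left h1 h3)

/-- The spatial part is Hermitian with scalar square `s²`, so it scales norms by `s`; Cauchy-Schwarz
then bounds its quadratic form by `s ‖ψ‖²`. -/
theorem inner_symbol_nonpos (hγ : IsGamma γ) (hn : Even n) {v : Spacetime n}
    (h : Real.sqrt (1 + spatialSq v) ≤ v 0) (ψ : Spinor n) :
    inner ℂ ψ (spinAct (symbol γ v) ψ) ≤ 0 := by
  have hs := spatialSq_nonneg v
  have hAA := hγ.spinAct_spatialSymbol_twice hn v ψ
  have hsa := hγ.inner_spatialSymbol_left hn v ψ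
  rw [hγ.spinAct_symbol]
  set s := Real.sqrt (1 + spatialSq v)
  have hs2 : s * s = 1 + spatialSq v := Real.mul_self_sqrt (by positivity)
  set A := spinAct (spatialSymbol γ v)
  have hn : ‖A ψ‖ = s * ‖ψ‖ := by
    have h1 : inner ℂ (A ψ) (A ψ) = ((s * s : ℝ) : ℂ) * inner ℂ ψ ψ := by
      rw [hsa, hAA, inner_smul_right, hs2]
    rw [inner_self_eq_ofReal, inner_self_eq_ofReal, ← Complex.ofReal_mul, Complex.ofReal_inj] at h1
    have h3 : ‖A ψ‖ ^ 2 = (s * ‖ψ‖) ^ 2 := by rw [h1]; ring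
    exact (pow_left_inj₀ (norm_nonneg _)
      (mul_nonneg (Real.sqrt_nonneg _) (norm_nonneg _)) two_ne_zero).1 h3
  have hre : ((inner ℂ ψ (A ψ) : ℂ).re : ℂ) = inner ℂ ψ (A ψ) := by
    rw [← Complex.conj_eq_iff_re, inner_conj_symm, hsa]
  have hle : (inner ℂ ψ (A ψ) : ℂ).re ≤ s * ‖ψ‖ ^ 2 := by
    refine (Complex.re_le_norm _).trans ((norm_inner_le_norm _ _).trans_eq ?_)
    rw [hn]; ring
  rw [inner_sub_right, inner_smul_right, inner_self_eq_ofReal, ← hre, ← Complex.ofReal_mul,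
    ← Complex.ofReal_sub, ← Complex.ofReal_zero, Complex.real_le_real]
  nlinarith [sq_nonneg ‖ψ‖]

end IsGamma

/-! ### The commutator with a smooth function -/

theorem isWeakDirac_dirac (γ : Fin n → SpinMatrix n) (φ : (dirac γ).domain) :
    IsWeakDirac γ φ (dirac γ φ) := by
  have h := (dirac γ).mem_graph φ
  rwa [dirac_graph] at h

theorem IsWeakDirac.exists_dirac_eq {γ : Fin n → SpinMatrix n} {φ ψ : SpinorL2 n}
    (h : IsWeakDirac γ φ ψ) : ∃ hφ : φ ∈ (dirac γ).domain, dirac γ ⟨φ, hφ⟩ = ψ := by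
  have h' : (φ, ψ) ∈ (dirac γ).graph := by rwa [dirac_graph]
  obtain ⟨y, hy, hy'⟩ := (LinearPMap.mem_graph_iff _).1 h'
  subst hy
  exact ⟨y.2, hy'⟩

theorem mulOp_coeFn (f : Spacetime n → ℝ) (φ : (mulOp f).domain) :
    mulOp f φ =ᵐ[volume] fun x => (f x : ℂ) • (φ : SpinorL2 n) x :=
  MemLp.coeFn_toLp φ.2

theorem mem_opProd_domain {H : Type*} [AddCommGroup H] [Module ℂ H] {S T : H →ₗ.[ℂ] H} {φ : H} :
    φ ∈ (opProd S T).domain ↔ ∃ h : φ ∈ T.domain, T ⟨φ, h⟩ ∈ S.domain := by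
  constructor
  · rintro ⟨y, hy, rfl⟩
    exact ⟨y.2, hy⟩
  · rintro ⟨h, h'⟩
    exact ⟨⟨φ, h⟩, h', rfl⟩

/-- The partial derivatives of a function, as a vector. -/
def partials (f : Spacetime n → ℝ) (x : Spacetime n) : Spacetime n := fun μ => partialDeriv μ f x

theorem partialDeriv_mul {f g : Spacetime n → ℝ} (hf : ContDiff ℝ ∞ f) (hg : ContDiff ℝ ∞ g)
    (μ : Fin n) (x : Spacetime n) :
    partialDeriv μ (f * g) x = partialDeriv μ f x * g x + f x * partialDeriv μ g x := by
  have h1 := (hf.differentiable (by simp)).differentiableAt (x := x)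
  have h2 := (hg.differentiable (by simp)).differentiableAt (x := x)
  rw [partialDeriv, fderiv_mul h1 h2]
  simp [partialDeriv]
  ring

theorem locallyIntegrable_comm (γ : Fin n → SpinMatrix n) {f : Spacetime n → ℝ}
    (hf : ContDiff ℝ ∞ f) (φ : SpinorL2 n) :
    LocallyIntegrable (fun x =>
      -Complex.I • ∑ μ, (partialDeriv μ f x : ℂ) • spinAct (γ μ) (φ x)) := by
  refine LocallyIntegrable.smul ?_ (-Complex.I)
  refine locallyIntegrable_finsetSum _ fun μ _ => ?_
  have h : MemLp (fun x => spinAct (γ μ) (φ x)) 2 volume :=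
    (spinAct (γ μ)).comp_memLp' (Lp.memLp φ)
  have := (h.locallyIntegrable (by norm_num)).continuous_smul
    (Complex.continuous_ofReal.comp (continuous_partialDeriv hf μ))
  exact this

theorem integral_test_comm (γ : Fin n → SpinMatrix n) {f η : Spacetime n → ℝ}
    (hf : ContDiff ℝ ∞ f) (hη : ContDiff ℝ ∞ η) (hc : HasCompactSupport η) (φ : SpinorL2 n) :
    ∫ x, η x • (-Complex.I • ∑ μ, (partialDeriv μ f x : ℂ) • spinAct (γ μ) (φ x))
      = -Complex.I • ∑ μ, spinAct (γ μ) (∫ x, (η x * partialDeriv μ f x) • φ x) := by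
  have hi (μ : Fin n) : Integrable fun x => (η x * partialDeriv μ f x) • φ x :=
    integrable_test_smul (hη.continuous.mul (continuous_partialDeriv hf μ)) hc.mul_right φ
  simp only [smul_comm (_ : ℝ) (-Complex.I), integral_smul]
  congr 1
  simp only [← ContinuousLinearMap.integral_comp_comm _ (hi _)]
  rw [← integral_finsetSum _ fun μ _ => (spinAct (γ μ)).integrable_comp (hi μ)]
  refine integral_congr_ae (ae_of_all _ fun x => ?_)
  simp only [Finset.smul_sum, Complex.coe_smul, smul_smul]
  refine Finset.sum_congr rfl fun μ _ => ?_
  exact (((spinAct (γ μ)).restrictScalars ℝ).map_smul _ _).symm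

/-- The commutator `[D, f]` acts as multiplication by `-iγ^μ ∂_μ f`. -/
theorem diracComm_coeFn (γ : Fin n → SpinMatrix n) {f : Spacetime n → ℝ}
    (hf : ContDiff ℝ ∞ f) (φ : (diracComm γ f).domain) :
    diracComm γ f φ =ᵐ[volume]
      fun x => -Complex.I • ∑ μ, (partialDeriv μ f x : ℂ) • spinAct (γ μ) ((φ : SpinorL2 n) x) := by
  have h12 : (φ : SpinorL2 n) ∈ (opProd (dirac γ) (mulOp f)).domain ∧
    (φ : SpinorL2 n) ∈ (opProd (mulOp f) (dirac γ)).domain := φ.2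
  obtain ⟨h1, h2⟩ := h12
  obtain ⟨m1, d1⟩ := mem_opProd_domain.1 h1
  obtain ⟨d2, m2⟩ := mem_opProd_domain.1 h2
  have hw1 := isWeakDirac_dirac γ ⟨_, d1⟩
  have hw2 := isWeakDirac_dirac γ ⟨_, d2⟩
  have hm1 := mulOp_coeFn f ⟨_, m1⟩
  have hm2 := mulOp_coeFn f ⟨_, m2⟩
  have heq : diracComm γ f φ = dirac γ ⟨_, d1⟩ - mulOp f ⟨_, m2⟩ := rfl
  rw [heq]
  set ψ₁ := dirac γ ⟨_, d1⟩
  set ψ₂ := mulOp f ⟨_, m2⟩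
  set φ₁ := mulOp f ⟨_, m1⟩
  set ψ := dirac γ ⟨_, d2⟩
  -- Both sides are compared as distributions. Testing `f Dφ` against `η` is testing `Dφ` against
  -- `ηf`, again a test function; the Leibniz rule for `∂_μ (ηf)` leaves only the term with `∂_μ f`.
  refine ae_eq_of_integral_contDiff_smul_eq ((Lp.memLp _).locallyIntegrable (by norm_num))
    (locallyIntegrable_comm γ hf _) fun η hη hc => ?_
  have e0 : ∫ x, η x • (ψ₁ - ψ₂ : SpinorL2 n) x = (∫ x, η x • ψ₁ x) - ∫ x, η x • ψ₂ x := by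
    have := integral_test_add hη.continuous hc (ψ₁ - ψ₂) ψ₂
    rw [sub_add_cancel] at this
    rw [this, add_sub_cancel_right]
  have e1 : ∫ x, η x • ψ₂ x = ∫ x, (η * f) x • ψ x := by
    refine integral_congr_ae ?_
    filter_upwards [hm2] with x hx
    rw [hx, Complex.coe_smul, smul_smul]; rfl
  have e2 (μ : Fin n) : ∫ x, partialDeriv μ (η * f) x • (φ : SpinorL2 n) x
      = (∫ x, partialDeriv μ η x • φ₁ x)
        + ∫ x, (η x * partialDeriv μ f x) • (φ : SpinorL2 n) x := by
    have e3 : ∫ x, partialDeriv μ η x • φ₁ x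
        = ∫ x, (partialDeriv μ η x * f x) • (φ : SpinorL2 n) x := by
      refine integral_congr_ae ?_
      filter_upwards [hm1] with x hx
      rw [hx, Complex.coe_smul, smul_smul]
    rw [e3, ← integral_add]
    · simp only [partialDeriv_mul hη hf, add_smul]
    · exact integrable_test_smul ((continuous_partialDeriv hη μ).mul hf.continuous)
        (hasCompactSupport_partialDeriv hc μ).mul_right _
    · exact integrable_test_smul (hη.continuous.mul (continuous_partialDeriv hf μ)) hc.mul_right _
  rw [e0, e1, hw1 η hη hc, hw2 (η * f) (hη.mul hf) hc.mul_right, integral_test_comm γ hf hη hc]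
  simp only [e2, map_add, Finset.sum_add_distrib, smul_add]
  rw [neg_smul]
  abel

/-! ### Test spinor fields -/

theorem memLp_test {w : Spacetime n → ℝ} (hw : Continuous w) (hc : HasCompactSupport w)
    (ξ : Spinor n) : MemLp (fun x => (w x : ℂ) • ξ) 2 (volume : Measure (Spacetime n)) := by
  have h : Continuous fun x => (w x : ℂ) • ξ := by fun_prop
  exact h.memLp_of_hasCompactSupport
    (hc.comp_left (g := fun r : ℝ => (r : ℂ) • ξ) (by simp))

theorem memLp_test_sum (γ : Fin n → SpinMatrix n) {w : Fin n → Spacetime n → ℝ}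
    (hw : ∀ μ, Continuous (w μ)) (hc : ∀ μ, HasCompactSupport (w μ)) (ξ : Spinor n) :
    MemLp (fun x => -Complex.I • ∑ μ, (w μ x : ℂ) • spinAct (γ μ) ξ) 2
      (volume : Measure (Spacetime n)) := by
  have h := memLp_finsetSum Finset.univ (f := fun μ x => (w μ x : ℂ) • spinAct (γ μ) ξ)
    fun μ _ => memLp_test (hw μ) (hc μ) _
  exact h.const_smul (-Complex.I)

/-- Integration by parts: for compactly supported fields the classical derivative is the weak one.
-/
theorem isWeakDirac_test (γ : Fin n → SpinMatrix n) {u : Spacetime n → ℝ}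
    (hu : ContDiff ℝ ∞ u) (huc : HasCompactSupport u) (ξ : Spinor n) {φ ψ : SpinorL2 n}
    (hφ : φ =ᵐ[volume] fun x => (u x : ℂ) • ξ)
    (hψ : ψ =ᵐ[volume] fun x => -Complex.I • ∑ μ, (partialDeriv μ u x : ℂ) • spinAct (γ μ) ξ) :
    IsWeakDirac γ φ ψ := by
  intro η hη hc
  have hL : ∫ x, η x • ψ x
      = ∫ x, -Complex.I • ∑ μ, (η x * partialDeriv μ u x) • spinAct (γ μ) ξ := by
    refine integral_congr_ae ?_
    filter_upwards [hψ] with x hx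
    rw [hx, smul_comm, Finset.smul_sum]
    simp only [Complex.coe_smul, smul_smul]
  have hR (μ : Fin n) : ∫ x, partialDeriv μ η x • φ x
      = (∫ x, partialDeriv μ η x * u x) • ξ := by
    rw [← integral_smul_const]
    refine integral_congr_ae ?_
    filter_upwards [hφ] with x hx
    rw [hx, Complex.coe_smul, smul_smul]
  have i1 (μ : Fin n) : Integrable fun x => η x * partialDeriv μ u x :=
    (hη.continuous.mul (continuous_partialDeriv hu μ)).integrable_of_hasCompactSupport hc.mul_right
  have i2 (μ : Fin n) : Integrable fun x => partialDeriv μ η x * u x :=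
    ((continuous_partialDeriv hη μ).mul hu.continuous).integrable_of_hasCompactSupport
      huc.mul_left
  have ibp (μ : Fin n) : ∫ x, η x * partialDeriv μ u x = -∫ x, partialDeriv μ η x * u x :=
    integral_mul_fderiv_eq_neg_fderiv_mul_of_integrable (i2 μ) (i1 μ)
      ((hη.continuous.mul hu.continuous).integrable_of_hasCompactSupport hc.mul_right)
      (fun x _ => (hη.differentiable (by simp)).differentiableAt)
      (fun x _ => (hu.differentiable (by simp)).differentiableAt)
  rw [hL, integral_smul, integral_finsetSum _ fun μ _ => (i1 μ).smul_const _]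
  simp only [hR, integral_smul_const, ibp, neg_smul, Finset.sum_neg_distrib, smul_neg, neg_neg]
  congr 1
  refine Finset.sum_congr rfl fun μ _ => ?_
  exact (((spinAct (γ μ)).restrictScalars ℝ).map_smul _ _).symm

/-- Test spinor fields lie in the domain of the commutator. -/
theorem exists_mem_domain (γ : Fin n → SpinMatrix n) {f u : Spacetime n → ℝ}
    (hf : ContDiff ℝ ∞ f) (hu : ContDiff ℝ ∞ u) (huc : HasCompactSupport u) (ξ : Spinor n) :
    ∃ φ : (diracComm γ f).domain, (φ : SpinorL2 n) =ᵐ[volume] fun x => (u x : ℂ) • ξ := by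
  have key {w : Spacetime n → ℝ} (hw : ContDiff ℝ ∞ w) (hwc : HasCompactSupport w) :
      ∃ φ ψ : SpinorL2 n, φ =ᵐ[volume] (fun x => (w x : ℂ) • ξ) ∧
        ψ =ᵐ[volume] (fun x => -Complex.I • ∑ μ, (partialDeriv μ w x : ℂ) • spinAct (γ μ) ξ) := by
    have m1 := memLp_test hw.continuous hwc ξ
    have m2 := memLp_test_sum γ (fun μ => continuous_partialDeriv hw μ)
      (fun μ => hasCompactSupport_partialDeriv hwc μ) ξ
    exact ⟨m1.toLp _, m2.toLp _, m1.coeFn_toLp, m2.coeFn_toLp⟩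
  obtain ⟨φ, ψ, hφ, hψ⟩ := key hu huc
  -- The product `fu` is again a test function, which places `fφ` in the domain of `D`.
  obtain ⟨φ', ψ', hφ', hψ'⟩ := key (hf.mul hu) huc.mul_left
  obtain ⟨d2, hd2⟩ := (isWeakDirac_test γ hu huc ξ hφ hψ).exists_dirac_eq
  obtain ⟨d1, -⟩ := (isWeakDirac_test γ (hf.mul hu) huc.mul_left ξ hφ' hψ').exists_dirac_eq
  have hfφ : (fun x => (f x : ℂ) • φ x) =ᵐ[volume] φ' := by
    filter_upwards [hφ, hφ'] with x h1 h2
    rw [h1, h2, smul_smul]; simp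
  have m1 : φ ∈ (mulOp f).domain := (memLp_congr_ae hfφ).2 (Lp.memLp φ')
  have e1 : mulOp f ⟨φ, m1⟩ = φ' := Lp.ext ((mulOp_coeFn f ⟨φ, m1⟩).trans hfφ)
  have m2 : ψ ∈ (mulOp f).domain := by
    have : (fun x => (f x : ℂ) • ψ x) =ᵐ[volume]
        fun x => -Complex.I • ∑ μ, ((f x * partialDeriv μ u x : ℝ) : ℂ) • spinAct (γ μ) ξ := by
      filter_upwards [hψ] with x hx
      rw [hx, smul_comm, Finset.smul_sum]
      simp only [smul_smul, Complex.ofReal_mul]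
    exact (memLp_congr_ae this).2 (memLp_test_sum γ
      (fun μ => hf.continuous.mul (continuous_partialDeriv hu μ))
      (fun μ => (hasCompactSupport_partialDeriv huc μ).mul_left) ξ)
  refine ⟨⟨φ, mem_opProd_domain.2 ⟨m1, ?_⟩, mem_opProd_domain.2 ⟨d2, ?_⟩⟩, hφ⟩
  · rw [e1]; exact d1
  · rw [hd2]; exact m2

/-! ### From the operator inequality to a pointwise one -/

theorem inner_constraint_eq [NeZero n] (γ : Fin n → SpinMatrix n) {f : Spacetime n → ℝ}
    (hf : ContDiff ℝ ∞ f) (φ : (diracComm γ f).domain) :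
    inner ℂ (φ : SpinorL2 n)
      (fundSymm γ (diracComm γ f φ + Complex.I • constOp (chirality γ) φ))
      = ∫ x, inner ℂ ((φ : SpinorL2 n) x)
          (spinAct (symbol γ (partials f x)) ((φ : SpinorL2 n) x)) := by
  rw [L2.inner_def]
  refine integral_congr_ae ?_
  filter_upwards [diracComm_coeFn γ hf φ,
    (spinAct (Complex.I • γ 0)).coeFn_compLpL (p := 2)
      (diracComm γ f φ + Complex.I • constOp (chirality γ) φ),
    Lp.coeFn_add (diracComm γ f φ) (Complex.I • constOp (chirality γ) φ),
    Lp.coeFn_smul Complex.I (constOp (chirality γ) (φ : SpinorL2 n)),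
    (spinAct (chirality γ)).coeFn_compLpL (p := 2) (φ : SpinorL2 n)] with x h1 h2 h3 h4 h5
  rw [fundSymm, constOp, h2, h3, Pi.add_apply, h1, h4, Pi.smul_apply, constOp, h5, symbol]
  congr 1
  simp only [spinAct, map_mul, map_add, map_smul, map_sum]
  simp only [mul_apply_eq_comp, add_apply, smul_apply, sum_apply, map_add,
    map_smul, map_sum, partials]

theorem continuous_inner_symbol [NeZero n] (γ : Fin n → SpinMatrix n) {f : Spacetime n → ℝ}
    (hf : ContDiff ℝ ∞ f) (ξ : Spinor n) :
    Continuous fun x => inner ℂ ξ (spinAct (symbol γ (partials f x)) ξ) := by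
  have h := fun μ => continuous_partialDeriv hf μ
  simp only [symbol, spinAct, map_mul, map_add, map_smul, map_sum, partials]
  simp only [mul_apply_eq_comp, add_apply,
    smul_apply, sum_apply]
  fun_prop

theorem inner_ofReal_smul {E : Type*} [NormedAddCommGroup E] [InnerProductSpace ℂ E]
    (A : E →L[ℂ] E) (r : ℝ) (ξ : E) :
    inner ℂ ((r : ℂ) • ξ) (A ((r : ℂ) • ξ)) = ((r ^ 2 : ℝ) : ℂ) * inner ℂ ξ (A ξ) := by
  rw [map_smul, inner_smul_left, inner_smul_right, Complex.conj_ofReal]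
  push_cast
  ring

theorem integral_inner_congr {X E : Type*} [MeasurableSpace X] {ν : Measure X}
    [NormedAddCommGroup E] [InnerProductSpace ℂ E] (A : X → E →L[ℂ] E) {φ : X → E} {u : X → ℝ}
    {ξ : E} (h : φ =ᵐ[ν] fun x => (u x : ℂ) • ξ) :
    ∫ x, inner ℂ (φ x) (A x (φ x)) ∂ν = ∫ x, ((u x ^ 2 : ℝ) : ℂ) * inner ℂ ξ (A x ξ) ∂ν := by
  refine integral_congr_ae ?_
  filter_upwards [h] with x hx
  rw [hx, inner_ofReal_smul]

/-- A bump function supported where `Re G > 0` does it. This converts a violation of the sign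
condition at one point into a violation in `L²`. -/
theorem exists_test_re_integral_pos {G : Spacetime n → ℂ} (hG : Continuous G) {x : Spacetime n}
    (hx : 0 < (G x).re) : ∃ u : Spacetime n → ℝ, ContDiff ℝ ∞ u ∧ HasCompactSupport u ∧
      0 < (∫ x, ((u x ^ 2 : ℝ) : ℂ) * G x).re := by
  have hgc : Continuous fun x => (G x).re := Complex.continuous_re.comp hG
  obtain ⟨u, hus, huc, hu, -, hux⟩ := exists_contDiff_tsupport_subset (n := ⊤)
    ((isOpen_Ioi.preimage hgc).mem_nhds hx)
  have huc' := hu.continuous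
  refine ⟨u, hu, huc, ?_⟩
  have hi : Integrable fun x => ((u x ^ 2 : ℝ) : ℂ) * G x := by
    have : Continuous fun x => ((u x ^ 2 : ℝ) : ℂ) * G x := by fun_prop
    refine this.integrable_of_hasCompactSupport ?_
    exact (huc.comp_left (g := fun r : ℝ => ((r ^ 2 : ℝ) : ℂ)) (by simp)).mul_right
  rw [← Complex.reCLM_apply, ← Complex.reCLM.integral_comp_comm hi]
  simp only [Complex.reCLM_apply, Complex.re_ofReal_mul]
  have hcs : HasCompactSupport fun x => u x ^ 2 * (G x).re :=
    (huc.comp_left (g := fun r : ℝ => r ^ 2) (by simp)).mul_right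
  refine ((huc'.pow 2).mul hgc).integral_pos_of_hasCompactSupport_nonneg_nonzero hcs
    (fun y => ?_) (x := x) ?_
  · by_cases hy : u y = 0
    · simp [hy]
    · exact mul_nonneg (sq_nonneg _) (le_of_lt (hus (subset_tsupport _ hy)))
  · rw [hux, one_pow, one_mul]; exact hx.ne'

/-- The constraint says that `∂_0 f ≥ √(1 + |∇f|²)` everywhere. -/
theorem IsGamma.constraint_iff [NeZero n] {γ : Fin n → SpinMatrix n} (hγ : IsGamma γ)
    (hn : Even n) {f : Spacetime n → ℝ} (hf : ContDiff ℝ ∞ f) :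
    Constraint γ f ↔
      ∀ x, Real.sqrt (1 + spatialSq (partials f x)) ≤ partials f x 0 := by
  constructor
  · intro h x
    refine hγ.sqrt_le_of_re_inner_symbol_nonpos hn fun ξ => ?_
    by_contra! hpos
    obtain ⟨u, hu, huc, hpos'⟩ := exists_test_re_integral_pos (continuous_inner_symbol γ hf ξ) hpos
    obtain ⟨φ, hφ⟩ := exists_mem_domain γ hf hu huc ξ
    have h1 := h φ
    rw [inner_constraint_eq γ hf, integral_inner_congr _ hφ] at h1
    exact hpos'.not_ge (Complex.le_def.1 h1).1
  · intro h φ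
    rw [inner_constraint_eq γ hf]
    have h1 (x : Spacetime n) := hγ.inner_symbol_nonpos hn (h x) ((φ : SpinorL2 n) x)
    -- The order on `ℂ` also demands a real value, so the integrand is first replaced by its real
    -- part.
    have h2 : ∫ x, inner ℂ ((φ : SpinorL2 n) x)
          (spinAct (symbol γ (partials f x)) ((φ : SpinorL2 n) x))
        = ∫ x, ((inner ℂ ((φ : SpinorL2 n) x)
          (spinAct (symbol γ (partials f x)) ((φ : SpinorL2 n) x)) : ℂ).re : ℂ) :=
      integral_congr_ae (ae_of_all _ fun x =>
        Complex.ext (Complex.ofReal_re _).symm (by rw [(Complex.le_def.1 (h1 x)).2]; simp))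
    rw [h2, integral_complex_ofReal, ← Complex.ofReal_zero, Complex.real_le_real]
    exact integral_nonpos fun x => (Complex.le_def.1 (h1 x)).1

/-! ### Lengths of causal curves -/

theorem metric_self [NeZero n] (v : Spacetime n) : metric v v = spatialSq v - v 0 ^ 2 := by
  rw [metric, spatialSq, ← Finset.add_sum_erase _ _ (Finset.mem_univ (0 : Fin n)),
    Finset.filter_ne', signature, if_pos rfl]
  have : ∑ μ ∈ Finset.univ.erase (0 : Fin n), signature μ * v μ * v μ
      = ∑ μ ∈ Finset.univ.erase (0 : Fin n), v μ ^ 2 :=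
    Finset.sum_congr rfl fun μ hμ => by
      rw [signature, if_neg (Finset.mem_erase.1 hμ).1]; ring
  rw [this]
  ring

theorem dotProduct_eq_time_add_space [NeZero n] (v w : Spacetime n) :
    v ⬝ᵥ w = v 0 * w 0 + ∑ a with a ≠ 0, v a * w a := by
  rw [dotProduct, Finset.filter_ne',
    Finset.add_sum_erase _ (fun μ => v μ * w μ) (Finset.mem_univ (0 : Fin n))]

/-- The reverse Cauchy-Schwarz inequality for a covector `v` with `v_0 ≥ √(1 + |v|²)`. -/
theorem sqrt_neg_metric_le_dotProduct [NeZero n] {v u : Spacetime n}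
    (hv : Real.sqrt (1 + spatialSq v) ≤ v 0) (hu : FutureCausal u) :
    Real.sqrt (-metric u u) ≤ v ⬝ᵥ u := by
  obtain ⟨hm, h0⟩ := hu
  have hS := spatialSq_nonneg v
  have hT := spatialSq_nonneg u
  have hCS : (∑ a with a ≠ (0 : Fin n), v a * u a) ^ 2 ≤ spatialSq v * spatialSq u :=
    Finset.sum_mul_sq_le_sq_mul_sq _ _ _
  rw [dotProduct_eq_time_add_space]
  have hC := (abs_le.1 (Real.abs_le_sqrt hCS)).1
  rw [Real.sqrt_mul hS] at hC
  rw [metric_self] at hm ⊢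
  have e1 := Real.sq_sqrt hS
  have e2 := Real.sq_sqrt hT
  have e3 : Real.sqrt (-(spatialSq u - u 0 ^ 2)) ^ 2 = -(spatialSq u - u 0 ^ 2) :=
    Real.sq_sqrt (by linarith)
  have e4 : Real.sqrt (1 + spatialSq v) ^ 2 = 1 + spatialSq v := Real.sq_sqrt (by linarith)
  have p4 := Real.sqrt_nonneg (1 + spatialSq v)
  set σ := Real.sqrt (spatialSq v)
  set τ := Real.sqrt (spatialSq u)
  set a := Real.sqrt (-(spatialSq u - u 0 ^ 2))
  set b := Real.sqrt (1 + spatialSq v)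
  -- Cauchy-Schwarz in the plane for `(1, σ)` and `(a, τ)`, whose norms are `b` and `u 0`; the
  -- defect of the squares is `(τ - σ a)²`.
  have key : a + σ * τ ≤ b * u 0 := by
    refine abs_le_of_sq_le_sq' ?_ (by positivity) |>.2
    have : (b * u 0) ^ 2 = (1 + σ ^ 2) * (a ^ 2 + τ ^ 2) := by rw [mul_pow, e4, e3, e2, e1]; ring
    rw [this]
    nlinarith [sq_nonneg (τ - σ * a)]
  have := mul_le_mul_of_nonneg_right hv h0.le
  linarith

/-! ### Steep functions along causal curves -/

theorem fderiv_eq_dotProduct (f : Spacetime n → ℝ) (x u : Spacetime n) :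
    fderiv ℝ f x u = partials f x ⬝ᵥ u := by
  nth_rw 1 [← Finset.univ_sum_single u]
  rw [map_sum, dotProduct]
  refine Finset.sum_congr rfl fun μ _ => ?_
  have : Pi.single μ (u μ) = u μ • (Pi.single μ 1 : Spacetime n) := by
    rw [← Pi.single_smul, smul_eq_mul, mul_one]
  rw [this, map_smul, smul_eq_mul, mul_comm]; rfl

/-- `∂_0 f ≥ √(1 + |∇f|²)` everywhere. -/
def Steep [NeZero n] (f : Spacetime n → ℝ) : Prop :=
  ∀ x, Real.sqrt (1 + spatialSq (partials f x)) ≤ partials f x 0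

/-- The derivative of `f ∘ c` dominates the length density, and the fundamental theorem of calculus
integrates it. Monotonicity is recorded because `ENNReal.ofReal` is additive only on nonnegative
increments when pieces are joined. -/
theorem Steep.lintegral_piece_le [NeZero n] {f : Spacetime n → ℝ} (hf : ContDiff ℝ ∞ f)
    (hs : Steep f) {c : ℝ → Spacetime n} {a b : ℝ} (hab : a < b)
    (hc : ContDiffOn ℝ ∞ c (Icc a b))
    (hP : ∀ s ∈ Icc a b, FutureCausal (derivWithin c (Icc a b) s)) :
    f (c a) ≤ f (c b) ∧
    ∫⁻ t in Icc a b, ENNReal.ofReal (Real.sqrt (-metric (deriv c t) (deriv c t)))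
      ≤ ENNReal.ofReal (f (c b) - f (c a)) := by
  have hg : ContDiffOn ℝ ∞ (f ∘ c) (Icc a b) := hf.comp_contDiffOn hc
  have hle : ∀ t ∈ Ioo a b, Real.sqrt (-metric (deriv c t) (deriv c t)) ≤ deriv (f ∘ c) t := by
    intro t ht
    have hn : Icc a b ∈ 𝓝 t := Icc_mem_nhds ht.1 ht.2
    have hd : HasDerivAt c (deriv c t) t :=
      ((hc.contDiffAt hn).differentiableAt (by simp)).hasDerivAt
    have hfd := (hf.differentiable (by simp)).differentiableAt (x := c t)
    have h1 := hP t (Ioo_subset_Icc_self ht)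
    rw [derivWithin_of_mem_nhds hn] at h1
    rw [(hfd.hasFDerivAt.comp_hasDerivAt t hd).deriv, fderiv_eq_dotProduct]
    exact sqrt_neg_metric_le_dotProduct (hs (c t)) h1
  -- At the endpoints `deriv` may take its default value, so integrability comes from the continuous
  -- one-sided `derivWithin`, which agrees with it in the interior.
  have hint : IntervalIntegrable (deriv (f ∘ c)) volume a b := by
    rw [intervalIntegrable_iff_integrableOn_Ioo_of_le hab.le]
    have h1 : ContinuousOn (derivWithin (f ∘ c) (Icc a b)) (Icc a b) :=
      hg.continuousOn_derivWithin (uniqueDiffOn_Icc hab) (by simp)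
    exact (h1.integrableOn_Icc.mono_set Ioo_subset_Icc_self).congr_fun
      (fun t ht => derivWithin_of_mem_nhds (Icc_mem_nhds ht.1 ht.2)) measurableSet_Ioo
  have hftc : ∫ t in a..b, deriv (f ∘ c) t = f (c b) - f (c a) := by
    refine intervalIntegral.integral_eq_sub_of_hasDerivAt_of_le hab.le hg.continuousOn
      (fun t ht => ?_) hint
    exact ((hg.contDiffAt (Icc_mem_nhds ht.1 ht.2)).differentiableAt (by simp)).hasDerivAt
  rw [intervalIntegral.integral_of_le hab.le, integral_Ioc_eq_integral_Ioo] at hftc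
  have hnn : ∀ᵐ t ∂(volume.restrict (Ioo a b)), 0 ≤ deriv (f ∘ c) t :=
    (ae_restrict_iff' measurableSet_Ioo).2
      (ae_of_all _ fun t ht => (Real.sqrt_nonneg _).trans (hle t ht))
  constructor
  · rw [← sub_nonneg, ← hftc]
    exact integral_nonneg_of_ae hnn
  · rw [← hftc, ofReal_integral_eq_lintegral_ofReal
      ((intervalIntegrable_iff_integrableOn_Ioo_of_le hab.le).1 hint) hnn,
      setLIntegral_congr Ioo_ae_eq_Icc.symm]
    exact setLIntegral_mono' measurableSet_Ioo fun t ht => ENNReal.ofReal_le_ofReal (hle t ht)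

theorem Steep.curveLength_le [NeZero n] {f : Spacetime n → ℝ} (hf : ContDiff ℝ ∞ f)
    (hs : Steep f) {p q : Spacetime n} {c : ℝ → Spacetime n} (hc : IsCurve FutureCausal p q c) :
    curveLength c ≤ ENNReal.ofReal (f q - f p) := by
  obtain ⟨rfl, rfl, k, t, ht0, htk, h⟩ := hc
  have key : ∀ j ≤ k, 0 ≤ t j ∧ f (c 0) ≤ f (c (t j)) ∧
      ∫⁻ s in Icc 0 (t j), ENNReal.ofReal (Real.sqrt (-metric (deriv c s) (deriv c s)))
        ≤ ENNReal.ofReal (f (c (t j)) - f (c 0)) := by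
    intro j
    induction j with
    | zero => intro _; simp [ht0]
    | succ j ih =>
      intro hj
      obtain ⟨i1, i2, i3⟩ := ih (by omega)
      obtain ⟨h1, h2, h3⟩ := h j hj
      obtain ⟨m1, m2⟩ := hs.lintegral_piece_le hf h1 h2 h3
      refine ⟨i1.trans h1.le, i2.trans m1, ?_⟩
      rw [← Icc_union_Icc_eq_Icc i1 h1.le]
      refine (lintegral_union_le _ _ _).trans ((add_le_add i3 m2).trans_eq ?_)
      rw [← ENNReal.ofReal_add (by linarith) (by linarith)]
      congr 1
      ring
  have := (key k le_rfl).2.2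
  rwa [htk] at this

theorem IsCurve.mono {P Q : Spacetime n → Prop} (hPQ : ∀ v, P v → Q v) {p q : Spacetime n}
    {c : ℝ → Spacetime n} (hc : IsCurve P p q c) : IsCurve Q p q c := by
  obtain ⟨h0, h1, k, t, ht0, htk, h⟩ := hc
  exact ⟨h0, h1, k, t, ht0, htk, fun i hi =>
    ⟨(h i hi).1, (h i hi).2.1, fun s hs => hPQ _ ((h i hi).2.2 s hs)⟩⟩

theorem FutureTimelike.futureCausal [NeZero n] {v : Spacetime n} (h : FutureTimelike v) :
    FutureCausal v := ⟨h.1.le, h.2⟩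

theorem continuous_metric_self [NeZero n] : Continuous fun v : Spacetime n => metric v v := by
  unfold metric
  fun_prop

/-- The length density is already positive throughout the interior of the first smooth piece. -/
theorem curveLength_pos [NeZero n] {p q : Spacetime n} {c : ℝ → Spacetime n}
    (hc : IsCurve FutureTimelike p q c) : 0 < curveLength c := by
  obtain ⟨-, -, k, t, ht0, htk, h⟩ := hc
  have hk : 0 < k := by
    rcases Nat.eq_zero_or_pos k with rfl | hk
    · rw [ht0] at htk; exact absurd htk zero_ne_one
    · exact hk
  have hle : ∀ j ≤ k, j ≠ 0 → t 1 ≤ t j := by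
    intro j
    induction j with
    | zero => intro _ h; exact absurd rfl h
    | succ j ih =>
      intro hj _
      rcases Nat.eq_zero_or_pos j with rfl | hj0
      · exact le_rfl
      · exact (ih (by omega) hj0.ne').trans (h j hj).1.le
  obtain ⟨h1, -, h3⟩ := h 0 hk
  rw [zero_add, ht0] at h1 h3
  have hsub : Ioo 0 (t 1) ⊆ Icc (0 : ℝ) 1 := fun s hs =>
    ⟨hs.1.le, hs.2.le.trans ((hle k le_rfl hk.ne').trans htk.le)⟩
  refine lt_of_lt_of_le ?_ (lintegral_mono_set hsub)
  have hm : Measurable fun s => ENNReal.ofReal (Real.sqrt (-metric (deriv c s) (deriv c s))) :=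
    ((continuous_metric_self.measurable.comp (measurable_deriv c)).neg.sqrt).ennreal_ofReal
  rw [setLIntegral_pos_iff hm]
  have : Ioo 0 (t 1) ⊆ Function.support fun s =>
      ENNReal.ofReal (Real.sqrt (-metric (deriv c s) (deriv c s))) := by
    intro s hs
    have hd := h3 s (Ioo_subset_Icc_self hs)
    rw [derivWithin_of_mem_nhds (Icc_mem_nhds hs.1 hs.2)] at hd
    rw [Function.mem_support]
    exact (ENNReal.ofReal_pos.2 (Real.sqrt_pos.2 (neg_pos.2 hd.1))).ne'
  rw [inter_eq_self_of_subset_right this, Real.volume_Ioo]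
  simpa using h1

/-- The straight segment from `p` to `q` has constant velocity `q - p`. -/
theorem le_lorentzDist [NeZero n] {p q : Spacetime n} (h : FutureCausal (q - p)) :
    ENNReal.ofReal (Real.sqrt (-metric (q - p) (q - p))) ≤ lorentzDist p q := by
  have hd (s : ℝ) : HasDerivAt (fun t : ℝ => p + t • (q - p)) (q - p) s := by
    simpa using ((hasDerivAt_id s).smul_const (q - p)).const_add p
  have hc : IsCurve FutureCausal p q fun t : ℝ => p + t • (q - p) := by
    refine ⟨by simp, by simp, 1, fun i => i, by simp, by simp, fun i hi => ?_⟩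
    have hlt : (i : ℝ) < ((i + 1 : ℕ) : ℝ) := by exact_mod_cast Nat.lt_succ_self i
    refine ⟨hlt, ContDiff.contDiffOn (by fun_prop), fun s hs => ?_⟩
    rw [(hd s).hasDerivWithinAt.derivWithin (uniqueDiffOn_Icc hlt s hs)]
    exact h
  refine le_trans ?_ (le_iSup₂ (f := fun c _ => curveLength c) _ hc)
  simp [curveLength, (hd _).deriv]

theorem lorentzDist_le_algDist [NeZero n] {γ : Fin n → SpinMatrix n} (hγ : IsGamma γ)
    (hn : Even n) (p q : Spacetime n) : lorentzDist p q ≤ algDist γ p q := by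
  refine iSup₂_le fun c hc => le_iInf₂ fun f hf => ?_
  rw [ENNReal.ofReal_max, ENNReal.ofReal_zero, max_eq_right (zero_le)]
  exact Steep.curveLength_le hf.1 ((hγ.constraint_iff hn hf.1).1 hf.2) hc

/-! ### Linear functions -/

/-- The linear function with partial derivatives `v`, as an affine map. -/
def linearFun (v : Spacetime n) : Spacetime n →ᵃ[ℝ] ℝ :=
  (∑ μ, v μ • LinearMap.proj (R := ℝ) (φ := fun _ : Fin n => ℝ) μ).toAffineMap

theorem linearFun_apply (v x : Spacetime n) : linearFun v x = v ⬝ᵥ x := by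
  simp [linearFun, dotProduct]

theorem linearFun_sub (v p q : Spacetime n) :
    linearFun v q - linearFun v p = v ⬝ᵥ (q - p) := by
  rw [linearFun_apply, linearFun_apply, dotProduct_sub]

theorem coe_linearFun (v : Spacetime n) : ⇑(linearFun v) =
    (∑ μ, v μ • ContinuousLinearMap.proj (R := ℝ) (φ := fun _ : Fin n => ℝ) μ) := by
  ext x; simp [linearFun]

theorem contDiff_linearFun (v : Spacetime n) : ContDiff ℝ ∞ (linearFun v) := by
  rw [coe_linearFun]
  exact ContinuousLinearMap.contDiff _

theorem partials_linearFun (v x : Spacetime n) : partials (linearFun v) x = v := by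
  ext μ
  rw [partials, partialDeriv, coe_linearFun, ContinuousLinearMap.fderiv]
  simp [Pi.single_apply]

theorem IsGamma.constraint_linearFun [NeZero n] {γ : Fin n → SpinMatrix n} (hγ : IsGamma γ)
    (hn : Even n) {v : Spacetime n} (hv : Real.sqrt (1 + spatialSq v) ≤ v 0) :
    Constraint γ (linearFun v) := by
  rw [hγ.constraint_iff hn (contDiff_linearFun v)]
  simpa only [partials_linearFun] using fun _ => hv

/-- The vector with time component `x` and the spatial part of `k • w`. -/
def withTime [NeZero n] (x k : ℝ) (w : Spacetime n) : Spacetime n :=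
  fun μ => if μ = 0 then x else k * w μ

theorem spatialSq_withTime [NeZero n] (x k : ℝ) (w : Spacetime n) :
    spatialSq (withTime x k w) = k ^ 2 * spatialSq w := by
  rw [spatialSq, spatialSq, Finset.mul_sum]
  refine Finset.sum_congr rfl fun a ha => ?_
  rw [withTime, if_neg (Finset.mem_filter.1 ha).2, mul_pow]

theorem withTime_dotProduct [NeZero n] (x k : ℝ) (w : Spacetime n) :
    withTime x k w ⬝ᵥ w = x * w 0 + k * spatialSq w := by
  rw [dotProduct_eq_time_add_space, spatialSq, Finset.mul_sum, withTime, if_pos rfl]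
  congr 1
  refine Finset.sum_congr rfl fun a ha => ?_
  rw [withTime, if_neg (Finset.mem_filter.1 ha).2]; ring

/-- The covector is `-g(w, ·)/√(-g(w, w))`: it is normalised, so the steepness condition holds with
equality, and it pairs with `w` to the proper length. -/
theorem FutureTimelike.exists_dotProduct_eq [NeZero n] {w : Spacetime n} (h : FutureTimelike w) :
    ∃ v : Spacetime n, Real.sqrt (1 + spatialSq v) ≤ v 0 ∧
      v ⬝ᵥ w = Real.sqrt (-metric w w) := by
  have hs : 0 < Real.sqrt (-metric w w) := Real.sqrt_pos.2 (neg_pos.2 h.1)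
  have h0 := h.2
  have hs2 : Real.sqrt (-metric w w) ^ 2 = w 0 ^ 2 - spatialSq w := by
    rw [Real.sq_sqrt (neg_pos.2 h.1).le, metric_self]; ring
  set s := Real.sqrt (-metric w w)
  refine ⟨withTime (w 0 / s) (-1 / s) w, ?_, ?_⟩
  · rw [spatialSq_withTime]
    have : 1 + (-1 / s) ^ 2 * spatialSq w = (w 0 / s) ^ 2 := by
      field_simp
      linarith
    rw [this, Real.sqrt_sq (by positivity)]
    simp [withTime]
  · rw [withTime_dotProduct]
    field_simp
    linarith

/-- Here `w 0 ≤ r`, with `r` the spatial norm of `w`. A covector with spatial part of size `t`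
pointing against `w` and time part `√(1 + t²)` pairs with `w` to at most `(√(1 + t²) - t) r ≤ r /
t`; the choice `t = r / ε` yields `ε`. For `r = 0` the time coordinate itself serves. -/
theorem exists_dotProduct_le_of_not_futureTimelike [NeZero n] {w : Spacetime n}
    (h : ¬FutureTimelike w) {ε : ℝ} (hε : 0 < ε) :
    ∃ v : Spacetime n, Real.sqrt (1 + spatialSq v) ≤ v 0 ∧ v ⬝ᵥ w ≤ ε := by
  have hT := spatialSq_nonneg w
  have hr2 := Real.sq_sqrt hT
  have hle : w 0 ≤ Real.sqrt (spatialSq w) := by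
    by_contra! hlt
    have h0 : 0 < w 0 := (Real.sqrt_nonneg _).trans_lt hlt
    refine h ⟨?_, h0⟩
    rw [metric_self, sub_neg]
    exact (Real.sqrt_lt' h0).1 hlt
  rcases (Real.sqrt_nonneg (spatialSq w)).eq_or_lt with hr | hr
  · refine ⟨withTime 1 0 w, by simp [spatialSq_withTime, withTime], ?_⟩
    rw [withTime_dotProduct, one_mul, zero_mul, add_zero]
    linarith
  · set r := Real.sqrt (spatialSq w)
    have ht : 0 < r / ε := by positivity
    have hsq : Real.sqrt (1 + (r / ε) ^ 2) ≤ r / ε + ε / r := by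
      refine Real.sqrt_le_iff.2 ⟨by positivity, ?_⟩
      have : (r / ε + ε / r) ^ 2 = (r / ε) ^ 2 + 2 + (ε / r) ^ 2 := by
        field_simp
        ring
      nlinarith [sq_nonneg (ε / r)]
    refine ⟨withTime (Real.sqrt (1 + (r / ε) ^ 2)) (-(1 / ε)) w, ?_, ?_⟩
    · rw [spatialSq_withTime, ← hr2]
      have : (-(1 / ε)) ^ 2 * r ^ 2 = (r / ε) ^ 2 := by ring
      rw [this]
      simp [withTime]
    · rw [withTime_dotProduct, ← hr2]
      calc _ ≤ (r / ε + ε / r) * r + -(1 / ε) * r ^ 2 := by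
            have := mul_le_mul_of_nonneg_left hle (Real.sqrt_nonneg (1 + (r / ε) ^ 2))
            have := mul_le_mul_of_nonneg_right hsq hr.le
            linarith
        _ = ε := by field_simp; ring

/-! ### Comparison of the two distances -/

theorem algDist_le_of_dotProduct_le [NeZero n] {γ : Fin n → SpinMatrix n} (hγ : IsGamma γ)
    (hn : Even n) {p q v : Spacetime n} (hv : Real.sqrt (1 + spatialSq v) ≤ v 0) :
    algDist γ p q ≤ ENNReal.ofReal (v ⬝ᵥ (q - p)) := by
  refine (iInf₂_le (f := fun (f : Spacetime n → ℝ) (_ : ContDiff ℝ ∞ f ∧ Constraint γ f) =>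
    ENNReal.ofReal (max 0 (f q - f p))) (linearFun v)
    ⟨contDiff_linearFun v, hγ.constraint_linearFun hn hv⟩).trans_eq ?_
  rw [linearFun_sub, ENNReal.ofReal_max, ENNReal.ofReal_zero, max_eq_right (zero_le)]

theorem algDist_eq_zero [NeZero n] {γ : Fin n → SpinMatrix n} (hγ : IsGamma γ)
    (hn : Even n) {p q : Spacetime n} (h : ¬FutureTimelike (q - p)) : algDist γ p q = 0 := by
  refine le_antisymm (ENNReal.le_of_forall_pos_le_add fun ε hε _ => ?_) (zero_le)
  obtain ⟨v, hv, hle⟩ := exists_dotProduct_le_of_not_futureTimelike h (NNReal.coe_pos.2 hε)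
  rw [zero_add]
  refine (algDist_le_of_dotProduct_le hγ hn hv).trans ?_
  simpa using ENNReal.ofReal_le_ofReal hle

end MinkowskiTriple

end

open MinkowskiTriple in
theorem mainTheorem4 (n : ℕ) [NeZero n] (hn : Even n) (γ : Fin n → SpinMatrix n)
    (hγ : IsGamma γ) :
    (∀ p q : Spacetime n, algDist γ p q = lorentzDist p q) ∧
    (∀ p q : Spacetime n, Chronological p q →
      ∃ f : Spacetime n →ᵃ[ℝ] ℝ, Constraint γ f ∧
        ENNReal.ofReal (max 0 (f q - f p)) = lorentzDist p q) := by
  have main : ∀ p q : Spacetime n, algDist γ p q = lorentzDist p q := by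
    intro p q
    refine le_antisymm ?_ (lorentzDist_le_algDist hγ hn p q)
    by_cases h : FutureTimelike (q - p)
    · obtain ⟨v, hv, hv'⟩ := h.exists_dotProduct_eq
      refine (algDist_le_of_dotProduct_le hγ hn hv).trans ?_
      rw [hv']
      exact le_lorentzDist h.futureCausal
    · rw [algDist_eq_zero hγ hn h]
      exact zero_le
  refine ⟨main, fun p q ⟨c, hc⟩ => ?_⟩
  have hpos : 0 < lorentzDist p q := (curveLength_pos hc).trans_le
    (le_iSup₂ (f := fun c _ => curveLength c) c (hc.mono fun _ => FutureTimelike.futureCausal))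
  -- A timelike curve makes the distance positive, whereas a displacement that is not future
  -- timelike would make it zero; so the convexity of the timelike cone is not needed.
  have h : FutureTimelike (q - p) := by
    by_contra h
    rw [← main, algDist_eq_zero hγ hn h] at hpos
    exact hpos.false
  obtain ⟨v, hv, hv'⟩ := h.exists_dotProduct_eq
  refine ⟨linearFun v, hγ.constraint_linearFun hn hv, le_antisymm ?_ ?_⟩
  · rw [linearFun_sub, hv', max_eq_right (Real.sqrt_nonneg _)]
    exact le_lorentzDist h.futureCausal
  · rw [← main]
    exact iInf₂_le _ ⟨contDiff_linearFun v, hγ.constraint_linearFun hn hv⟩
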